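/- Let $(X,Y)$ be a bivariate normal random vector with zero mean vector, variances $\sigma_X^2,\sigma_Y^2$ ($\sigma_X,\sigma_Y>0$) and correlation coefficient $\rho\in(-1,1)$. Let $n\ge 1$, let $Z_1,\dots,Z_n$ be independent random variables, each distributed as the product $Z=XY$, and put $\overline{Z}_n=\frac1n(Z_1+\cdots+Z_n)$ and $s_n=\sigma_X\sigma_Y/n$. Let ${}_2F_1(a,b;c;\cdot)$ denote the principal branch of the hypergeometric function, that is, the analytic continuation to $\mathbb{C}\setminus[1,\infty)$ of the Gauss series $\sum_{j\ge0}\frac{(a)_j(b)_j}{(c)_j\,j!}z^j$, $|z|<1$. Then for every integer $k\ge1$ the $k$-th moment of $\overline{Z}_n$ exists, $$\mathbb{E}\big[\overline{Z}_n^{\,k}\big]=\frac{s_n^k\,(n+k-1)!\,k!}{(1-\rho^2)^{n/2}\,\Gamma(\frac n2+k+1)\,\Gamma(\frac n2)}\bigg[(-1)^k(1-\rho)^{n+k}\,{}_2F_1\Big(n+k,\tfrac n2;\tfrac n2+k+1;-\tfrac{1-\rho}{1+\rho}\Big)+(1+\rho)^{n+k}\,{}_2F_1\Big(n+k,\tfrac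 n2;\tfrac n2+k+1;-\tfrac{1+\rho}{1-\rho}\Big)\bigg]$$ and $$\mathbb{E}\big|\overline{Z}_n^{\,k}\big|=\frac{s_n^k\,(n+k-1)!\,k!}{(1-\rho^2)^{n/2}\,\Gamma(\frac n2+k+1)\,\Gamma(\frac n2)}\bigg[(1-\rho)^{n+k}\,{}_2F_1\Big(n+k,\tfrac n2;\tfrac n2+k+1;-\tfrac{1-\rho}{1+\rho}\Big)+(1+\rho)^{n+k}\,{}_2F_1\Big(n+k,\tfrac n2;\tfrac n2+k+1;-\tfrac{1+\rho}{1-\rho}\Big)\bigg].$$ -/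

import Mathlib

open MeasureTheory ProbabilityTheory
open scoped Nat

/-- `(X, Y)` is a bivariate normal random vector with zero mean vector, variances
`σX ^ 2`, `σY ^ 2` and correlation coefficient `ρ`. -/
structure IsCenteredBivariateNormal {Ω : Type*} [MeasurableSpace Ω] (P : Measure Ω)
    (X Y : Ω → ℝ) (σX σY ρ : ℝ) : Prop where
  gaussian : HasGaussianLaw (fun ω => (X ω, Y ω)) P
  mean_left : ∫ ω, X ω ∂P = 0
  mean_right : ∫ ω, Y ω ∂P = 0
  variance_left : variance X P = σX ^ 2
  variance_right : variance Y P = σY ^ 2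
  covariance_eq : covariance X Y P = ρ * (σX * σY)

/-- The mean `(Z₁ + ⋯ + Zₙ) / n`. -/
noncomputable def sampleMean {Ω : Type*} {n : ℕ} (Z : Fin n → Ω → ℝ) (ω : Ω) : ℝ :=
  (∑ i, Z i ω) / n

/-- The complex plane cut along the half-line `[1, ∞)`. -/
def hypergeometricDomain : Set ℂ := {z | 1 - z ∈ Complex.slitPlane}

/-- `F` is an analytic continuation to the plane cut along `[1, ∞)` of the Gauss series
`∑ (a)_j (b)_j / ((c)_j j!) z ^ j`, `|z| < 1` (which is Mathlib's `₂F₁`). -/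
structure IsHypergeometricBranch (a b c : ℂ) (F : ℂ → ℂ) : Prop where
  analytic : AnalyticOnNhd ℂ F hypergeometricDomain
  eq_series : ∀ z : ℂ, ‖z‖ < 1 → F z = ₂F₁ a b c z

open Classical in
/-- The principal branch of the hypergeometric function on the plane cut along `[1, ∞)`: the
analytic continuation of the Gauss series. -/
noncomputable def gaussHypergeometric (a b c z : ℂ) : ℂ :=
  if h : ∃ F : ℂ → ℂ, IsHypergeometricBranch a b c F then h.choose z else 0

/-- The continuation is unique on the cut plane, so `gaussHypergeometric` is well defined there. -/
theorem IsHypergeometricBranch.gaussHypergeometric_eq {a b c : ℂ} {F : ℂ → ℂ}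
    (hF : IsHypergeometricBranch a b c F) {z : ℂ} (hz : z ∈ hypergeometricDomain) :
    gaussHypergeometric a b c z = F z := by
  have hex : ∃ F : ℂ → ℂ, IsHypergeometricBranch a b c F := ⟨F, hF⟩
  have hG := hex.choose_spec
  have hconn : IsPreconnected hypergeometricDomain := by
    have himg : hypergeometricDomain = (fun w : ℂ => 1 - w) '' Complex.slitPlane := by
      ext w
      constructor
      · intro hw
        exact ⟨1 - w, hw, by simp⟩
      · rintro ⟨v, hv, rfl⟩
        simpa [hypergeometricDomain] using hv
    rw [himg]
    exact (Complex.starConvex_one_slitPlane.isPathConnected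
      (by simp)).isConnected.isPreconnected.image _ (by fun_prop)
  have h0 : (0 : ℂ) ∈ hypergeometricDomain := by simp [hypergeometricDomain]
  have hev : hex.choose =ᶠ[nhds 0] F := by
    filter_upwards [Metric.ball_mem_nhds (0 : ℂ) one_pos] with w hw
    have hw' : ‖w‖ < 1 := by simpa using hw
    rw [hG.eq_series w hw', hF.eq_series w hw']
  rw [gaussHypergeometric, dif_pos hex]
  exact hG.analytic.eqOn_of_preconnected_of_eventuallyEq hF.analytic hconn h0 hev hz

/-! After scaling by `σX * σY`, the sum of the `Z i` has the law of a difference of two independent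
gamma variables of shape `n / 2` and scales `1 + ρ` and `1 - ρ`. For standardised `A`, `B` one has
`4AB = (A + B)² - (A - B)²`, and `A ± B` are independent centred Gaussians of variance `2(1 ± ρ)`.
The moment generating functions of the two laws therefore agree near `0`
(`map_sum_eq_map_sub_gammaMeasure`), and this determines the law (`ext_of_mgf_eqOn_Ioo`).

A power of a difference splits into its positive and negative parts. For each part, substituting `y
= x u` and integrating out `x` leaves a beta average of `(α + β u)⁻ᴺ`
(`integral_posPart_sub_gammaMeasure`). This is Euler's integral for `₂F₁`; being analytic on the
whole cut plane, it computes the principal branch (`isHypergeometricBranch_eulerIntegral`),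
including at arguments below `-1`, where the Gauss series diverges. -/

/-! ### Beta measure: density and moments. -/

theorem integrable_betaPDFReal {a b : ℝ} (ha : 0 < a) (hb : 0 < b) :
    Integrable (betaPDFReal a b) ∧ ∫ x, betaPDFReal a b x = 1 := by
  have hnn : ∀ x, 0 ≤ betaPDFReal a b x := by
    intro x
    by_cases hx : 0 < x ∧ x < 1
    · exact (betaPDFReal_pos hx.1 hx.2 ha hb).le
    · simp [betaPDFReal, hx]
  have h1 : ∫⁻ x, ENNReal.ofReal (betaPDFReal a b x) = 1 := lintegral_betaPDF_eq_one ha hb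
  have hm : AEStronglyMeasurable (betaPDFReal a b) volume :=
    (stronglyMeasurable_betaPDFReal a b).aestronglyMeasurable
  refine ⟨(lintegral_ofReal_ne_top_iff_integrable hm (.of_forall hnn)).1 (by simp [h1]), ?_⟩
  rw [integral_eq_lintegral_of_nonneg_ae (.of_forall hnn) hm, h1, ENNReal.toReal_one]

theorem ae_betaMeasure_mem_Ioo (a b : ℝ) : ∀ᵐ u ∂betaMeasure a b, u ∈ Set.Ioo (0 : ℝ) 1 := by
  have hm : Measurable (betaPDF a b) := (measurable_betaPDFReal a b).ennreal_ofReal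
  rw [betaMeasure, ae_withDensity_iff hm]
  refine .of_forall fun x hx => ?_
  by_contra hx'
  have : ¬ (0 < x ∧ x < 1) := hx'
  simp [betaPDF_eq, this] at hx

theorem integral_betaMeasure {E : Type*} [NormedAddCommGroup E] [NormedSpace ℝ E]
    {a b : ℝ} (ha : 0 < a) (hb : 0 < b) (f : ℝ → E) :
    ∫ u, f u ∂betaMeasure a b = ∫ u, betaPDFReal a b u • f u := by
  have hm : Measurable (betaPDF a b) := (measurable_betaPDFReal a b).ennreal_ofReal
  rw [betaMeasure, integral_withDensity_eq_integral_toReal_smul hm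
    (.of_forall fun _ => ENNReal.ofReal_lt_top)]
  refine integral_congr_ae (.of_forall fun x => ?_)
  have : 0 ≤ betaPDFReal a b x := by
    by_cases hx : 0 < x ∧ x < 1
    · exact (betaPDFReal_pos hx.1 hx.2 ha hb).le
    · simp [betaPDFReal, hx]
  simp [betaPDF, ENNReal.toReal_ofReal this]

theorem beta_add_nat_div_beta {a b : ℝ} (ha : 0 < a) (hb : 0 < b) (j : ℕ) :
    beta (a + j) b / beta a b =
      (ascPochhammer ℝ j).eval a / (ascPochhammer ℝ j).eval (a + b) := by
  have hG : ∀ x : ℝ, 0 < x →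
      Real.Gamma (x + j) = (ascPochhammer ℝ j).eval x * Real.Gamma x := by
    intro x hx
    induction j with
    | zero => simp
    | succ j ih =>
      have : x + (j + 1 : ℕ) = (x + j) + 1 := by push_cast; ring
      rw [this, Real.Gamma_add_one (by positivity), ih, ascPochhammer_succ_eval]
      ring
  have hab : a + j + b = (a + b) + j := by ring
  have h1 := ascPochhammer_pos j (a + b) (by positivity)
  rw [beta, beta, hab, hG a ha, hG (a + b) (by positivity)]
  have := Real.Gamma_pos_of_pos ha
  have := Real.Gamma_pos_of_pos hb
  have := Real.Gamma_pos_of_pos (add_pos ha hb)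
  field_simp

/-- Multiplying the beta density by `u ^ j` shifts its first parameter to `a + j`, so the moment is
a ratio of normalising constants. -/
theorem integral_pow_betaMeasure {a b : ℝ} (ha : 0 < a) (hb : 0 < b) (j : ℕ) :
    ∫ u, u ^ j ∂betaMeasure a b =
      (ascPochhammer ℝ j).eval a / (ascPochhammer ℝ j).eval (a + b) := by
  have haj : 0 < a + j := by positivity
  have hb0 := beta_pos ha hb
  have hb1 := beta_pos haj hb
  rw [integral_betaMeasure ha hb, ← beta_add_nat_div_beta ha hb]
  have : ∀ u, betaPDFReal a b u • u ^ j =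
      beta (a + j) b / beta a b * betaPDFReal (a + j) b u := by
    intro u
    by_cases hu : 0 < u ∧ u < 1
    · have : u ^ (a + j - 1) = u ^ (a - 1) * u ^ j := by
        rw [← Real.rpow_natCast, ← Real.rpow_add hu.1]; ring_nf
      simp only [betaPDFReal, hu, and_self, if_true, smul_eq_mul, this]
      field_simp
    · simp [betaPDFReal, hu]
  simp_rw [this]
  rw [integral_const_mul, (integrable_betaPDFReal haj hb).2, mul_one]

/-! ### Euler's integral as the continuation of the Gauss series. -/

theorem one_sub_mul_ne_zero_of_mem_hypergeometricDomain {z : ℂ} (hz : z ∈ hypergeometricDomain)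
    {u : ℝ} (hu : u ∈ Set.Icc (0 : ℝ) 1) : 1 - z * u ≠ 0 := by
  intro h
  have hz' : 1 - z ∈ Complex.slitPlane := hz
  have h1 : z * u = 1 := (sub_eq_zero.1 h).symm
  have hu0 : u ≠ 0 := by rintro rfl; simp at h1
  have hup : 0 < u := lt_of_le_of_ne hu.1 hu0.symm
  have hzu : z = ((1 / u : ℝ) : ℂ) := by
    push_cast
    rw [eq_div_iff (by exact_mod_cast hu0), h1]
  have h2 : (1 - z) = ((1 - 1 / u : ℝ) : ℂ) := by rw [hzu]; push_cast; ring
  rw [h2, Complex.ofReal_mem_slitPlane] at hz'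
  have : 1 ≤ 1 / u := by rw [le_div_iff₀ hup]; linarith [hu.2]
  linarith

theorem isOpen_hypergeometricDomain : IsOpen hypergeometricDomain :=
  Complex.isOpen_slitPlane.preimage (by fun_prop)

theorem continuousOn_inv_one_sub_mul_pow (N : ℕ) :
    ContinuousOn (fun p : ℂ × ℝ => ((1 - p.1 * p.2) ^ N)⁻¹)
      (hypergeometricDomain ×ˢ Set.Icc (0 : ℝ) 1) := by
  refine ContinuousOn.inv₀ (by fun_prop) fun p hp => pow_ne_zero _ ?_
  exact one_sub_mul_ne_zero_of_mem_hypergeometricDomain hp.1 hp.2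

theorem integrable_inv_one_sub_mul_pow (μ : Measure ℝ) [IsFiniteMeasure μ]
    (hμ : ∀ᵐ u ∂μ, u ∈ Set.Icc (0 : ℝ) 1) (N : ℕ) {z : ℂ} (hz : z ∈ hypergeometricDomain) :
    Integrable (fun u : ℝ => ((1 - z * u) ^ N)⁻¹) μ := by
  have hc : ContinuousOn (fun u : ℝ => ((1 - z * u) ^ N)⁻¹) (Set.Icc (0 : ℝ) 1) :=
    (continuousOn_inv_one_sub_mul_pow N).comp (f := fun u : ℝ => (z, u)) (by fun_prop)
      fun u hu => ⟨hz, hu⟩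
  obtain ⟨C, hC⟩ := isCompact_Icc.exists_bound_of_continuousOn hc
  exact .of_bound (by fun_prop) C (hμ.mono hC)

/-- Differentiation under the integral sign: the `z`-derivative of the integrand is bounded on the
compact product of a closed ball in the domain with `[0, 1]`. -/
theorem analyticOnNhd_integral_inv_one_sub_mul_pow (μ : Measure ℝ) [IsFiniteMeasure μ]
    (hμ : ∀ᵐ u ∂μ, u ∈ Set.Icc (0 : ℝ) 1) (N : ℕ) :
    AnalyticOnNhd ℂ (fun z : ℂ => ∫ u : ℝ, ((1 - z * u) ^ N)⁻¹ ∂μ) hypergeometricDomain := by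
  refine DifferentiableOn.analyticOnNhd (fun z hz => ?_) isOpen_hypergeometricDomain
  obtain ⟨ε, hε, hball⟩ := Metric.nhds_basis_closedBall.mem_iff.1
    (isOpen_hypergeometricDomain.mem_nhds hz)
  have hc : ContinuousOn (fun p : ℂ × ℝ => (N * p.2) * ((1 - p.1 * p.2) ^ (N + 1))⁻¹)
      (Metric.closedBall z ε ×ˢ Set.Icc (0 : ℝ) 1) :=
    ContinuousOn.mul (by fun_prop)
      ((continuousOn_inv_one_sub_mul_pow (N + 1)).mono (Set.prod_mono_left hball))
  obtain ⟨C, hC⟩ := ((isCompact_closedBall z ε).prod isCompact_Icc).exists_bound_of_continuousOn hc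
  have key := hasDerivAt_integral_of_dominated_loc_of_deriv_le (μ := μ) (𝕜 := ℂ)
    (F := fun (z : ℂ) (u : ℝ) => ((1 - z * u) ^ N)⁻¹)
    (F' := fun (z : ℂ) (u : ℝ) => (N * u) * ((1 - z * u) ^ (N + 1))⁻¹)
    (bound := fun _ => C) (Metric.closedBall_mem_nhds z hε)
    (.of_forall fun w => by fun_prop)
    (integrable_inv_one_sub_mul_pow μ hμ N hz) (by fun_prop)
    (hμ.mono fun u hu w hw => hC (w, u) ⟨hw, hu⟩) (integrable_const C)
    (hμ.mono fun u hu w hw => ?_)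
  · exact key.2.differentiableAt.differentiableWithinAt
  · have hne := one_sub_mul_ne_zero_of_mem_hypergeometricDomain (hball hw) hu
    have h1 : HasDerivAt (fun w : ℂ => 1 - w * u) (-u) w := by
      simpa using ((hasDerivAt_id w).mul_const (u : ℂ)).const_sub 1
    have h2 := (h1.pow N).inv (pow_ne_zero N hne)
    refine h2.congr_deriv ?_
    change -(↑N * (1 - w * ↑u) ^ (N - 1) * -↑u) / ((1 - w * ↑u) ^ N) ^ 2 = _
    rcases N with _ | N
    · simp
    · simp only [Nat.add_sub_cancel]
      field_simp
      ring

/-- Integrate the negative binomial series termwise: its coefficient `(j + m).choose m` is `(m +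
1)_j / j!`, and the `j`-th beta moment supplies `(b)_j / (b + c)_j`. -/
theorem integral_inv_one_sub_mul_pow_eq_ordinaryHypergeometric {b c : ℝ} (hb : 0 < b)
    (hc : 0 < c) (m : ℕ) {z : ℂ} (hz : ‖z‖ < 1) :
    ∫ u : ℝ, ((1 - z * u) ^ (m + 1))⁻¹ ∂betaMeasure b c =
      ₂F₁ ((m + 1 : ℕ) : ℂ) (b : ℂ) ((b + c : ℝ) : ℂ) z := by
  have := isProbabilityMeasureBeta hb hc
  have hae := ae_betaMeasure_mem_Ioo b c
  have hzu : ∀ u : ℝ, u ∈ Set.Ioo (0 : ℝ) 1 → ‖z * u‖ ≤ ‖z‖ := by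
    intro u hu
    rw [norm_mul, Complex.norm_real, Real.norm_of_nonneg hu.1.le]
    exact mul_le_of_le_one_right (norm_nonneg _) hu.2.le
  have hsum := hasSum_integral_of_dominated_convergence (μ := betaMeasure b c)
    (F := fun (j : ℕ) (u : ℝ) => ((j + m).choose m : ℂ) * (z * u) ^ j)
    (f := fun u : ℝ => ((1 - z * u) ^ (m + 1))⁻¹)
    (fun j _ => ((j + m).choose m : ℝ) * ‖z‖ ^ j)
    (fun j => by fun_prop)
    (fun j => hae.mono fun u hu => by
      rw [norm_mul, norm_pow, Complex.norm_natCast]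
      gcongr
      exact hzu u hu)
    (.of_forall fun _ => summable_choose_mul_geometric_of_norm_lt_one m (by simpa using hz))
    (integrable_const _)
    (hae.mono fun u hu => by
      simpa using hasSum_choose_mul_geometric_of_norm_lt_one m ((hzu u hu).trans_lt hz))
  rw [← hsum.tsum_eq, ordinaryHypergeometric_eq_tsum]
  refine tsum_congr fun j => ?_
  have h1 : ∫ u : ℝ, ((j + m).choose m : ℂ) * (z * u) ^ j ∂betaMeasure b c =
      ((j + m).choose m : ℂ) * z ^ j * ((∫ u : ℝ, u ^ j ∂betaMeasure b c : ℝ) : ℂ) := by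
    rw [← integral_complex_ofReal, ← integral_const_mul]
    congr with u
    push_cast
    ring
  have h2 : ∀ x : ℝ, (ascPochhammer ℂ j).eval (x : ℂ) = ((ascPochhammer ℝ j).eval x : ℝ) := by
    intro x
    rw [← ascPochhammer_map Complex.ofRealHom, ← Complex.ofRealHom_eq_coe, Polynomial.eval_map,
      Polynomial.eval₂_hom, Complex.ofRealHom_eq_coe]
  have h3 : (ascPochhammer ℂ j).eval ((m + 1 : ℕ) : ℂ) = j ! * ((j + m).choose m : ℂ) := by
    rw [← ascPochhammer_eval_cast, ascPochhammer_nat_eq_ascFactorial,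
      Nat.ascFactorial_eq_factorial_mul_choose, add_comm j m, Nat.choose_symm_add]
    push_cast
    ring
  have hj : (j ! : ℂ) ≠ 0 := by exact_mod_cast j.factorial_ne_zero
  rw [h1, integral_pow_betaMeasure hb hc, h2, h2, h3, smul_eq_mul]
  push_cast
  field_simp

theorem isHypergeometricBranch_eulerIntegral {b c : ℝ} (hb : 0 < b) (hc : 0 < c)
    {N : ℕ} (hN : 1 ≤ N) :
    IsHypergeometricBranch (N : ℂ) (b : ℂ) ((b + c : ℝ) : ℂ)
      (fun z => ∫ u : ℝ, ((1 - z * u) ^ N)⁻¹ ∂betaMeasure b c) := by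
  have := isProbabilityMeasureBeta hb hc
  obtain ⟨m, rfl⟩ := Nat.exists_eq_add_of_le' hN
  exact ⟨analyticOnNhd_integral_inv_one_sub_mul_pow _
      ((ae_betaMeasure_mem_Ioo b c).mono fun u hu => Set.Ioo_subset_Icc_self hu) _,
    fun z hz => integral_inv_one_sub_mul_pow_eq_ordinaryHypergeometric hb hc m hz⟩

theorem gaussHypergeometric_neg_ofReal {b c : ℝ} (hb : 0 < b) (hc : 0 < c)
    {N : ℕ} (hN : 1 ≤ N) {t : ℝ} (ht : 0 ≤ t) :
    gaussHypergeometric (N : ℂ) (b : ℂ) ((b + c : ℝ) : ℂ) (-(t : ℂ)) =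
      ((∫ u : ℝ, ((1 + t * u) ^ N)⁻¹ ∂betaMeasure b c : ℝ) : ℂ) := by
  have hmem : -(t : ℂ) ∈ hypergeometricDomain := by
    have : 1 - -(t : ℂ) = ((1 + t : ℝ) : ℂ) := by push_cast; ring
    rw [hypergeometricDomain, Set.mem_ofPred_eq, this, Complex.ofReal_mem_slitPlane]
    linarith
  rw [(isHypergeometricBranch_eulerIntegral hb hc hN).gaussHypergeometric_eq hmem,
    ← integral_complex_ofReal]
  congr with u
  push_cast
  ring

/-! ### Positive-part moments of a difference of gamma variables. -/

theorem lintegral_gammaMeasure (a r : ℝ) {f : ℝ → ENNReal} (hf : Measurable f) :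
    ∫⁻ x, f x ∂gammaMeasure a r = ∫⁻ x, gammaPDF a r x * f x := by
  have hm : Measurable (gammaPDF a r) := (measurable_gammaPDFReal a r).ennreal_ofReal
  rw [gammaMeasure, lintegral_withDensity_eq_lintegral_mul _ hm hf]
  rfl

theorem lintegral_pow_mul_exp_neg_mul_Ioi {N : ℕ} (hN : 1 ≤ N) {c : ℝ} (hc : 0 < c) :
    ∫⁻ x in Set.Ioi (0 : ℝ), ENNReal.ofReal (x ^ (N - 1) * Real.exp (-(c * x))) =
      ENNReal.ofReal ((N - 1)! * (c ^ N)⁻¹) := by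
  have hN' : (0 : ℝ) < N := by exact_mod_cast hN
  have h := Real.integral_rpow_mul_exp_neg_mul_Ioi hN' hc
  have hcast : (N : ℝ) - 1 = ((N - 1 : ℕ) : ℝ) := by rw [Nat.cast_sub hN, Nat.cast_one]
  have hG : Real.Gamma N = (N - 1)! := by
    rw [← Real.Gamma_nat_eq_factorial, ← hcast, sub_add_cancel]
  rw [hcast, hG] at h
  simp only [Real.rpow_natCast, one_div, inv_pow] at h
  have hpos : 0 < ((c ^ N)⁻¹ * (N - 1)! : ℝ) := by positivity
  have hint : IntegrableOn (fun x : ℝ => x ^ (N - 1) * Real.exp (-(c * x))) (Set.Ioi 0) := by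
    -- A non-integrable function has integral `0` by convention, but the value found is positive.
    by_contra hcon
    rw [integral_undef hcon] at h
    exact hpos.ne h
  rw [← ofReal_integral_eq_lintegral_ofReal hint, h, mul_comm]
  filter_upwards [ae_restrict_mem measurableSet_Ioi] with x hx
  have : (0 : ℝ) < x := hx
  positivity

/-- The integrand after `y = x u`, with Jacobian `x`; the powers of `x` collect to `2a + k - 1 = N -
1`. The point `u = 0` is excluded because there the gamma density need not vanish while the beta
density does. -/
theorem gammaPDFReal_mul_gammaPDFReal_mul {a α β : ℝ} (ha : 0 < a)
    {k N : ℕ} (hk : 1 ≤ k) (hN : (N : ℝ) = 2 * a + k) {x u : ℝ} (hx : 0 < x) (hu : u ≠ 0) :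
    gammaPDFReal a α x * (x * (gammaPDFReal a β (x * u) * max (x - x * u) 0 ^ k)) =
      α ^ a * β ^ a / Real.Gamma a ^ 2 * beta a (k + 1) *
        (betaPDFReal a (k + 1) u * (x ^ (N - 1) * Real.exp (-((α + β * u) * x)))) := by
  have hN1 : 1 ≤ N := by
    have : (0 : ℝ) < N := by rw [hN]; positivity
    exact_mod_cast this
  rcases lt_or_gt_of_ne hu with hu | hu
  · have h1 : ¬ 0 ≤ x * u := not_le.2 (mul_neg_of_pos_of_neg hx hu)
    have h2 : ¬ (0 < u ∧ u < 1) := fun h => absurd h.1 hu.not_gt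
    simp [gammaPDFReal, betaPDFReal, h1, h2]
  rcases le_or_gt 1 u with hu1 | hu1
  · have h1 : max (x - x * u) 0 = 0 := max_eq_right (by nlinarith)
    have h2 : ¬ (0 < u ∧ u < 1) := fun h => absurd h.2 hu1.not_gt
    simp [betaPDFReal, h1, h2, Nat.one_le_iff_ne_zero.1 hk]
  have h1 : max (x - x * u) 0 = x * (1 - u) := by
    rw [max_eq_left (by nlinarith)]; ring
  have hΓ := Real.Gamma_pos_of_pos ha
  have hb := beta_pos ha (by positivity : (0 : ℝ) < k + 1)
  have hexp : Real.exp (-((α + β * u) * x)) =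
      Real.exp (-(α * x)) * Real.exp (-(β * (x * u))) := by
    rw [← Real.exp_add]; ring_nf
  have hxN : x ^ (N - 1) = x ^ (a - 1) * x * x ^ (a - 1) * x ^ k := by
    have : x ^ (a - 1) * x = x ^ a := by
      rw [← Real.rpow_add_one hx.ne']; ring_nf
    rw [this, ← Real.rpow_natCast, ← Real.rpow_natCast, ← Real.rpow_add hx, ← Real.rpow_add hx,
      Nat.cast_sub hN1, hN]
    push_cast
    ring_nf
  simp only [gammaPDFReal, betaPDFReal, hx.le, (mul_pos hx hu).le, hu, hu1, and_self, if_true, h1,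
    mul_pow, Real.mul_rpow hx.le hu.le, hexp, hxN, add_sub_cancel_right, Real.rpow_natCast]
  field_simp

theorem lintegral_comp_const_mul {f : ℝ → ENNReal} (hf : Measurable f) {x : ℝ} (hx : 0 < x) :
    ∫⁻ y, f y = ∫⁻ u, ENNReal.ofReal x * f (x * u) := by
  have h := Real.smul_map_volume_mul_left hx.ne'
  rw [lintegral_const_mul _ (by fun_prop)]
  conv_lhs => rw [← h]
  rw [lintegral_smul_measure, lintegral_map hf (by fun_prop), abs_of_pos hx]
  rfl

/-- Working with `∫⁻` lets Tonelli exchange `x` and `u` before integrability is known; finiteness of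
the result later yields it. -/
theorem lintegral_posPart_sub_gammaMeasure {a α β : ℝ} (ha : 0 < a) (hα : 0 < α) (hβ : 0 < β)
    {k N : ℕ} (hk : 1 ≤ k) (hN : (N : ℝ) = 2 * a + k) :
    ∫⁻ p : ℝ × ℝ, ENNReal.ofReal (max (p.1 - p.2) 0 ^ k)
        ∂((gammaMeasure a α).prod (gammaMeasure a β)) =
      ∫⁻ u, ENNReal.ofReal (α ^ a * β ^ a / Real.Gamma a ^ 2 * beta a (k + 1) *
        ((N - 1)! * ((α + β * u) ^ N)⁻¹)) ∂betaMeasure a (k + 1) := by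
  have hN1 : 1 ≤ N := by
    have : (0 : ℝ) < N := by rw [hN]; positivity
    exact_mod_cast this
  have := isProbabilityMeasure_gammaMeasure ha hα
  have := isProbabilityMeasure_gammaMeasure ha hβ
  have hk1 : (0 : ℝ) < k + 1 := by positivity
  set K := α ^ a * β ^ a / Real.Gamma a ^ 2 * beta a (k + 1) with hK
  have hK0 : 0 ≤ K := by
    have := Real.Gamma_pos_of_pos ha
    have := beta_pos ha hk1
    positivity
  have hgm : ∀ r, Measurable (gammaPDF a r) := fun r =>
    (measurable_gammaPDFReal a r).ennreal_ofReal
  have hbm : Measurable (betaPDF a (k + 1)) := (measurable_betaPDFReal a (k + 1)).ennreal_ofReal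
  have hmeas : Measurable fun p : ℝ × ℝ => ENNReal.ofReal (max (p.1 - p.2) 0 ^ k) := by fun_prop
  rw [lintegral_prod _ hmeas.aemeasurable,
    lintegral_gammaMeasure _ _ hmeas.lintegral_prod_right']
  have hinner : ∀ x, 0 < x →
      gammaPDF a α x * ∫⁻ y, ENNReal.ofReal (max (x - y) 0 ^ k) ∂gammaMeasure a β =
      ∫⁻ u, ENNReal.ofReal K * (betaPDF a (k + 1) u *
        ENNReal.ofReal (x ^ (N - 1) * Real.exp (-((α + β * u) * x)))) := by
    intro x hx
    rw [lintegral_gammaMeasure _ _ (by fun_prop), lintegral_comp_const_mul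
      (f := fun y => gammaPDF a β y * ENNReal.ofReal (max (x - y) 0 ^ k))
      ((hgm β).mul (by fun_prop)) hx, ← lintegral_const_mul]
    · refine lintegral_congr_ae ?_
      filter_upwards [Measure.ae_ne volume (0 : ℝ)] with u hu
      have h := gammaPDFReal_mul_gammaPDFReal_mul (α := α) (β := β) ha hk hN hx hu
      have hb : 0 ≤ betaPDFReal a (k + 1) u := by
        by_cases h : 0 < u ∧ u < 1
        · exact (betaPDFReal_pos h.1 h.2 ha hk1).le
        · simp [betaPDFReal, h]
      rw [gammaPDF, gammaPDF, betaPDF, ← ENNReal.ofReal_mul (gammaPDFReal_nonneg ha hβ _),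
        ← ENNReal.ofReal_mul hx.le, ← ENNReal.ofReal_mul (gammaPDFReal_nonneg ha hα _),
        ← ENNReal.ofReal_mul hb, ← ENNReal.ofReal_mul hK0, h]
    · exact measurable_const.mul (((hgm β).comp (by fun_prop)).mul (by fun_prop))
  have hzero : ∫⁻ x, gammaPDF a α x * ∫⁻ y, ENNReal.ofReal (max (x - y) 0 ^ k) ∂gammaMeasure a β =
      ∫⁻ x in Set.Ioi 0,
        gammaPDF a α x * ∫⁻ y, ENNReal.ofReal (max (x - y) 0 ^ k) ∂gammaMeasure a β := by
    rw [setLIntegral_congr Ioi_ae_eq_Ici, ← lintegral_indicator measurableSet_Ici]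
    congr with x
    by_cases hx : 0 ≤ x
    · simp [hx]
    · simp [hx, gammaPDF_of_neg (not_le.1 hx)]
  rw [hzero, setLIntegral_congr_fun measurableSet_Ioi hinner, lintegral_lintegral_swap, betaMeasure,
    lintegral_withDensity_eq_lintegral_mul _ hbm (by fun_prop)]
  · refine lintegral_congr fun u => ?_
    rw [lintegral_const_mul _ (by fun_prop), lintegral_const_mul _ (by fun_prop), Pi.mul_apply]
    by_cases hu : 0 < u ∧ u < 1
    · have hc : 0 < α + β * u := by have := hu.1; positivity
      rw [lintegral_pow_mul_exp_neg_mul_Ioi hN1 hc, ENNReal.ofReal_mul hK0]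
      ring
    · simp [betaPDF_eq, hu]
  · refine Measurable.aemeasurable ?_
    exact measurable_const.mul ((hbm.comp measurable_snd).mul (by fun_prop))

theorem integrable_inv_add_mul_pow_betaMeasure {a b α β : ℝ} (ha : 0 < a) (hb : 0 < b)
    (hα : 0 < α) (hβ : 0 < β) (N : ℕ) :
    Integrable (fun u => ((α + β * u) ^ N)⁻¹) (betaMeasure a b) := by
  have := isProbabilityMeasureBeta ha hb
  refine .of_bound (by fun_prop) ((α ^ N)⁻¹) ?_
  filter_upwards [ae_betaMeasure_mem_Ioo a b] with u hu
  have := hu.1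
  rw [Real.norm_of_nonneg (by positivity)]
  gcongr
  nlinarith

theorem integral_posPart_sub_gammaMeasure {a α β : ℝ} (ha : 0 < a) (hα : 0 < α) (hβ : 0 < β)
    {k N : ℕ} (hk : 1 ≤ k) (hN : (N : ℝ) = 2 * a + k) :
    Integrable (fun p : ℝ × ℝ => max (p.1 - p.2) 0 ^ k)
        ((gammaMeasure a α).prod (gammaMeasure a β)) ∧
      ∫ p : ℝ × ℝ, max (p.1 - p.2) 0 ^ k ∂((gammaMeasure a α).prod (gammaMeasure a β)) =
        α ^ a * β ^ a / Real.Gamma a ^ 2 * beta a (k + 1) * (N - 1)! *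
          ∫ u, ((α + β * u) ^ N)⁻¹ ∂betaMeasure a (k + 1) := by
  have hk1 : (0 : ℝ) < k + 1 := by positivity
  have h := lintegral_posPart_sub_gammaMeasure ha hα hβ hk hN
  have hint := ((integrable_inv_add_mul_pow_betaMeasure ha hk1 hα hβ N).const_mul
    ((N - 1)! : ℝ)).const_mul (α ^ a * β ^ a / Real.Gamma a ^ 2 * beta a (k + 1))
  have hΓ := Real.Gamma_pos_of_pos ha
  have hb := beta_pos ha hk1
  have hI : 0 ≤ ∫ u, ((α + β * u) ^ N)⁻¹ ∂betaMeasure a (k + 1) := by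
    refine integral_nonneg_of_ae ?_
    filter_upwards [ae_betaMeasure_mem_Ioo a (k + 1)] with u hu
    have := hu.1
    positivity
  rw [← ofReal_integral_eq_lintegral_ofReal hint, integral_const_mul, integral_const_mul,
    ← mul_assoc] at h
  · have hnn : ∀ p : ℝ × ℝ, 0 ≤ max (p.1 - p.2) 0 ^ k := fun p => by positivity
    have hm : AEStronglyMeasurable (fun p : ℝ × ℝ => max (p.1 - p.2) 0 ^ k)
        ((gammaMeasure a α).prod (gammaMeasure a β)) := by fun_prop
    refine ⟨(lintegral_ofReal_ne_top_iff_integrable hm (.of_forall hnn)).1 (h ▸ ENNReal.ofReal_ne_top), ?_⟩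
    rw [integral_eq_lintegral_of_nonneg_ae (.of_forall hnn) hm, h, ENNReal.toReal_ofReal]
    positivity
  · filter_upwards [ae_betaMeasure_mem_Ioo a (k + 1)] with u hu
    have := hu.1
    positivity

/-! ### The law of the sum, via moment generating functions. -/

/-- The complex generating functions are analytic on the strip `|Re z| < ε` and agree on its real
segment, hence everywhere; on the imaginary axis they are the characteristic functions. Nonvanishing
encodes existence, since `mgf` is `0` where the exponential is not integrable. -/
theorem ext_of_mgf_eqOn_Ioo {μ ν : Measure ℝ} [IsProbabilityMeasure μ] [IsProbabilityMeasure ν]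
    {ε : ℝ} (hε : 0 < ε) (hne : ∀ t ∈ Set.Ioo (-ε) ε, mgf id μ t ≠ 0)
    (heq : ∀ t ∈ Set.Ioo (-ε) ε, mgf id μ t = mgf id ν t) : μ = ν := by
  have hint : ∀ (κ : Measure ℝ), (∀ t ∈ Set.Ioo (-ε) ε, mgf id κ t ≠ 0) →
      Set.Ioo (-ε) ε ⊆ interior (integrableExpSet id κ) := by
    intro κ hκ
    refine interior_maximal (fun t ht => ?_) isOpen_Ioo
    by_contra hcon
    exact hκ t ht (mgf_undef hcon)
  have hμ := hint μ hne
  have hν := hint ν fun t ht => heq t ht ▸ hne t ht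
  set S : Set ℂ := {z | z.re ∈ Set.Ioo (-ε) ε} with hS
  have h0 : (0 : ℂ) ∈ S := by simp [hS, hε]
  have key : Set.EqOn (complexMGF id μ) (complexMGF id ν) S := by
    refine AnalyticOnNhd.eqOn_of_preconnected_of_frequently_eq (z₀ := 0)
      (analyticOnNhd_complexMGF.mono fun z hz => hμ hz)
      (analyticOnNhd_complexMGF.mono fun z hz => hν hz)
      ((convex_Ioo (-ε) ε).linear_preimage Complex.reLm).isPreconnected h0 ?_
    have h_real : ∃ᶠ x : ℝ in nhdsWithin 0 {0}ᶜ, complexMGF id μ x = complexMGF id ν x := by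
      refine Filter.Eventually.frequently ?_
      filter_upwards [nhdsWithin_le_nhds (Ioo_mem_nhds (neg_lt_zero.2 hε) hε)] with t ht
      rw [complexMGF_ofReal, complexMGF_ofReal, heq t ht]
    have hmap : Filter.Tendsto (fun x : ℝ => (x : ℂ)) (nhdsWithin 0 {0}ᶜ)
        (nhdsWithin 0 {0}ᶜ) := by
      refine tendsto_nhdsWithin_of_tendsto_nhds_of_eventually_within _ ?_ ?_
      · exact (by simpa using Complex.continuous_ofReal.tendsto 0 :
          Filter.Tendsto (fun x : ℝ => (x : ℂ)) (nhds 0) (nhds 0)).mono_left nhdsWithin_le_nhds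
      · filter_upwards [self_mem_nhdsWithin] with x hx
        simpa using hx
    exact hmap.frequently h_real
  refine Measure.ext_of_charFun (funext fun t => ?_)
  rw [← complexMGF_id_mul_I, ← complexMGF_id_mul_I]
  exact key (by simp [hS, hε])

theorem mgf_sq_gaussianReal {v : NNReal} (hv : v ≠ 0) {s : ℝ} (hs : 2 * v * s < 1) :
    mgf (fun x => x ^ 2) (gaussianReal 0 v) s = (1 - 2 * v * s) ^ (-(1 / 2) : ℝ) := by
  have hv' : (0 : ℝ) < v := by positivity
  have h1 : 0 < 1 - 2 * v * s := by linarith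
  rw [mgf, integral_gaussianReal_eq_integral_smul hv]
  have : ∀ x : ℝ, gaussianPDFReal 0 v x • Real.exp (s * x ^ 2) =
      (√(2 * Real.pi * v))⁻¹ * Real.exp (-((1 - 2 * v * s) / (2 * v)) * x ^ 2) := by
    intro x
    rw [gaussianPDFReal, smul_eq_mul, mul_assoc, ← Real.exp_add]
    congr 2
    field_simp
    ring
  simp_rw [this]
  rw [integral_const_mul, integral_gaussian, Real.rpow_neg h1.le, ← Real.sqrt_eq_rpow,
    ← Real.sqrt_inv, ← Real.sqrt_mul (by positivity), ← Real.sqrt_inv]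
  congr 1
  field_simp

theorem mgf_id_gammaMeasure {a α : ℝ} (ha : 0 < a) (hα : 0 < α) {t : ℝ} (ht : t < α) :
    mgf id (gammaMeasure a α) t = (1 - t / α) ^ (-a) := by
  have hm : Measurable (gammaPDF a α) := (measurable_gammaPDFReal a α).ennreal_ofReal
  have hαt : 0 < α - t := by linarith
  rw [mgf, gammaMeasure, integral_withDensity_eq_integral_toReal_smul hm
    (.of_forall fun _ => ENNReal.ofReal_lt_top)]
  have h1 : ∀ x, (gammaPDF a α x).toReal • Real.exp (t * id x) =
      (Set.Ici (0 : ℝ)).indicator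
        (fun x => α ^ a / Real.Gamma a * (x ^ (a - 1) * Real.exp (-((α - t) * x)))) x := by
    intro x
    rw [gammaPDF, ENNReal.toReal_ofReal (gammaPDFReal_nonneg ha hα x), gammaPDFReal]
    by_cases hx : 0 ≤ x
    · have : Real.exp (-((α - t) * x)) = Real.exp (-(α * x)) * Real.exp (t * x) := by
        rw [← Real.exp_add]; ring_nf
      simp only [hx, if_true, Set.indicator_of_mem (Set.mem_Ici.2 hx), this, id, smul_eq_mul]
      ring
    · simp [hx]
  simp_rw [h1]
  have hΓ := Real.Gamma_pos_of_pos ha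
  have h2 : 1 - t / α = (α - t) / α := by field_simp
  rw [integral_indicator measurableSet_Ici, integral_Ici_eq_integral_Ioi, integral_const_mul,
    Real.integral_rpow_mul_exp_neg_mul_Ioi ha hαt, h2, Real.rpow_neg (by positivity),
    Real.div_rpow hαt.le hα.le, Real.div_rpow zero_le_one hαt.le, Real.one_rpow]
  field_simp

theorem mgf_sub_prod {μ ν : Measure ℝ} [SFinite μ] [SFinite ν] (t : ℝ) :
    mgf (fun p : ℝ × ℝ => p.1 - p.2) (μ.prod ν) t = mgf id μ t * mgf id ν (-t) := by
  simp only [mgf, id]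
  rw [← integral_prod_mul]
  congr with p
  rw [← Real.exp_add]
  ring_nf

theorem ProbabilityTheory.HasGaussianLaw.mgf_sq {Ω : Type*} [MeasurableSpace Ω] {P : Measure Ω} {U : Ω → ℝ}
    (hU : HasGaussianLaw U P) (h0 : ∫ ω, U ω ∂P = 0) {v : ℝ} (hv : 0 < v)
    (hvar : variance U P = v) {s : ℝ} (hs : 2 * v * s < 1) :
    mgf (fun ω => U ω ^ 2) P s = (1 - 2 * v * s) ^ (-(1 / 2) : ℝ) := by
  have hmap := hU.map_eq_gaussianReal
  rw [h0, hvar] at hmap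
  have hc : ((v.toNNReal : NNReal) : ℝ) = v := Real.coe_toNNReal v hv.le
  have h := mgf_sq_gaussianReal (v := v.toNNReal) (by simpa using hv) (s := s) (by rwa [hc])
  rw [hc, ← hmap, mgf_map hU.aemeasurable (by fun_prop)] at h
  exact h

theorem IsCenteredBivariateNormal.mgf_mul {Ω : Type*} [MeasurableSpace Ω] {P : Measure Ω}
    [IsProbabilityMeasure P] {X Y : Ω → ℝ} {σX σY ρ : ℝ} (hσX : 0 < σX) (hσY : 0 < σY)
    (hρ : -1 < ρ) (hρ' : ρ < 1) (h : IsCenteredBivariateNormal P X Y σX σY ρ) {t : ℝ}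
    (ht : (1 + ρ) * t < 1) (ht' : -((1 - ρ) * t) < 1) :
    mgf (fun ω => X ω * Y ω) P (t / (σX * σY)) =
      (1 - (1 + ρ) * t) ^ (-(1 / 2) : ℝ) * (1 + (1 - ρ) * t) ^ (-(1 / 2) : ℝ) := by
  have hX := h.gaussian.fst
  have hY := h.gaussian.snd
  set A : Ω → ℝ := fun ω => σX⁻¹ * X ω with hA
  set B : Ω → ℝ := fun ω => σY⁻¹ * Y ω with hB
  have hA2 : MemLp A 2 P := hX.memLp_two.const_mul _
  have hB2 : MemLp B 2 P := hY.memLp_two.const_mul _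
  have hAB : HasGaussianLaw (fun ω => (A ω + B ω, A ω - B ω)) P := by
    have := h.gaussian.map_fun
      (((σX⁻¹ • ContinuousLinearMap.fst ℝ ℝ ℝ) + (σY⁻¹ • ContinuousLinearMap.snd ℝ ℝ ℝ)).prod
        ((σX⁻¹ • ContinuousLinearMap.fst ℝ ℝ ℝ) - (σY⁻¹ • ContinuousLinearMap.snd ℝ ℝ ℝ)))
    simpa [hA, hB] using this
  have hvA : variance A P = 1 := by
    rw [hA, variance_const_mul, h.variance_left]; field_simp
  have hvB : variance B P = 1 := by
    rw [hB, variance_const_mul, h.variance_right]; field_simp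
  have hcov : covariance A B P = ρ := by
    rw [hA, hB, covariance_const_mul_left, covariance_const_mul_right, h.covariance_eq]
    field_simp
  have hAm : AEMeasurable A P := hA2.aestronglyMeasurable.aemeasurable
  have hBm : AEMeasurable B P := hB2.aestronglyMeasurable.aemeasurable
  have hiA : ∫ ω, A ω ∂P = 0 := by rw [hA, integral_const_mul, h.mean_left, mul_zero]
  have hiB : ∫ ω, B ω ∂P = 0 := by rw [hB, integral_const_mul, h.mean_right, mul_zero]
  have hAi : Integrable A P := hA2.integrable one_le_two
  have hBi : Integrable B P := hB2.integrable one_le_two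
  -- The covariance of `A + B` and `A - B` is `Var A - Var B = 0`, and jointly Gaussian uncorrelated
  -- variables are independent.
  have hind : IndepFun (fun ω => A ω + B ω) (fun ω => A ω - B ω) P := by
    refine hAB.indepFun_of_covariance_eq_zero ?_
    change covariance (A + B) (A - B) P = 0
    rw [covariance_add_left hA2 hB2 (hA2.sub hB2), covariance_sub_right hA2 hA2 hB2,
      covariance_sub_right hB2 hA2 hB2, covariance_self hAm, covariance_self hBm, hvA, hvB,
      covariance_comm B A]
    ring
  -- The factor `1 / 4` comes from `AB = ((A + B)² - (A - B)²) / 4`.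
  have hU := hAB.fst.mgf_sq (v := 2 * (1 + ρ)) (s := t / 4)
    (by rw [integral_add hAi hBi, hiA, hiB, add_zero]) (by linarith)
    (by
      change variance (A + B) P = _
      rw [variance_add hA2 hB2, hvA, hvB, hcov]; ring) (by linarith)
  have hV := hAB.snd.mgf_sq (v := 2 * (1 - ρ)) (s := -(t / 4))
    (by rw [integral_sub hAi hBi, hiA, hiB, sub_zero]) (by linarith)
    (by
      change variance (A - B) P = _
      rw [variance_sub hA2 hB2, hvA, hvB, hcov]; ring) (by linarith)
  have hind2 : IndepFun (fun ω => t / 4 * (A ω + B ω) ^ 2) (fun ω => -(t / 4) * (A ω - B ω) ^ 2) P :=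
    hind.comp (by fun_prop : Measurable fun x : ℝ => t / 4 * x ^ 2)
      (by fun_prop : Measurable fun x : ℝ => -(t / 4) * x ^ 2)
  have hmul := hind2.mgf_add' (t := 1) (by fun_prop) (by fun_prop)
  rw [mgf_const_mul, mgf_const_mul, mul_one, mul_one, hU, hV] at hmul
  convert hmul using 1
  · rw [mgf, mgf]
    congr with ω
    simp only [Pi.add_apply, hA, hB]
    congr 1
    field_simp
    ring
  · congr 2 <;> ring

theorem map_sum_eq_map_sub_gammaMeasure
    {Ω' : Type*} [MeasurableSpace Ω'] {P' : Measure Ω'} [IsProbabilityMeasure P']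
    {Ω : Type*} [MeasurableSpace Ω] {P : Measure Ω} [IsProbabilityMeasure P]
    {X Y : Ω' → ℝ} {σX σY ρ : ℝ} (hσX : 0 < σX) (hσY : 0 < σY) (hρ : -1 < ρ) (hρ' : ρ < 1)
    (hXY : IsCenteredBivariateNormal P' X Y σX σY ρ)
    {n : ℕ} (hn : 1 ≤ n) {Z : Fin n → Ω → ℝ} (hZindep : iIndepFun Z P)
    (hZ : ∀ i, IdentDistrib (Z i) (fun ω => X ω * Y ω) P P') :
    P.map (fun ω => (∑ i, Z i ω) / (σX * σY)) =
      ((gammaMeasure (n / 2) (1 + ρ)⁻¹).prod (gammaMeasure (n / 2) (1 - ρ)⁻¹)).map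
        (fun p => p.1 - p.2) := by
  have hr : (0 : ℝ) < n / 2 := by positivity
  have h1 : 0 < (1 + ρ)⁻¹ := inv_pos.2 (by linarith)
  have h2 : 0 < (1 - ρ)⁻¹ := inv_pos.2 (by linarith)
  have := isProbabilityMeasure_gammaMeasure hr h1
  have := isProbabilityMeasure_gammaMeasure hr h2
  have hZm : ∀ i, AEMeasurable (Z i) P := fun i => (hZ i).aemeasurable_fst
  have hSm : AEMeasurable (fun ω => (∑ i, Z i ω) / (σX * σY)) P := by fun_prop
  have := Measure.isProbabilityMeasure_map (μ := P) hSm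
  have := Measure.isProbabilityMeasure_map
    (μ := (gammaMeasure (n / 2) (1 + ρ)⁻¹).prod (gammaMeasure (n / 2) (1 - ρ)⁻¹))
    (f := fun p : ℝ × ℝ => p.1 - p.2) (by fun_prop)
  -- The radius `1 / 2` works for every `ρ`, since `1 ± ρ` lies in `(0, 2)`.
  have hlt : ∀ t ∈ Set.Ioo (-(1 / 2) : ℝ) (1 / 2), (1 + ρ) * t < 1 ∧ -((1 - ρ) * t) < 1 := by
    rintro t ⟨ht, ht'⟩
    constructor <;> nlinarith
  have hL : ∀ t ∈ Set.Ioo (-(1 / 2) : ℝ) (1 / 2),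
      mgf id (P.map (fun ω => (∑ i, Z i ω) / (σX * σY))) t =
        (1 - (1 + ρ) * t) ^ (-(n / 2) : ℝ) * (1 + (1 - ρ) * t) ^ (-(n / 2) : ℝ) := by
    intro t ht
    obtain ⟨ht1, ht2⟩ := hlt t ht
    have hfun : (fun ω => (∑ i, Z i ω) / (σX * σY)) =
        fun ω => (σX * σY)⁻¹ * (∑ i, Z i) ω := by
      ext ω
      rw [Finset.sum_apply, div_eq_inv_mul]
    rw [mgf_id_map hSm, hfun, mgf_const_mul, hZindep.mgf_sum₀ hZm,
      Finset.prod_congr rfl fun i _ => by rw [mgf_congr_identDistrib (hZ i)], Finset.prod_const,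
      Finset.card_univ, Fintype.card_fin, ← div_eq_inv_mul, hXY.mgf_mul hσX hσY hρ hρ' ht1 ht2,
      mul_pow, ← Real.rpow_mul_natCast (by linarith), ← Real.rpow_mul_natCast (by linarith)]
    ring_nf
  refine ext_of_mgf_eqOn_Ioo (ε := 1 / 2) (by norm_num) (fun t ht => ?_) (fun t ht => ?_)
  · obtain ⟨ht1, ht2⟩ := hlt t ht
    rw [hL t ht]
    exact mul_ne_zero (Real.rpow_pos_of_pos (by linarith) _).ne'
      (Real.rpow_pos_of_pos (by linarith) _).ne'
  · obtain ⟨ht1, ht2⟩ := hlt t ht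
    have hp : 0 < 1 + ρ := by linarith
    have hm : 0 < 1 - ρ := by linarith
    rw [hL t ht, mgf_id_map (by fun_prop), mgf_sub_prod, mgf_id_gammaMeasure hr h1,
      mgf_id_gammaMeasure hr h2]
    · congr 2 <;> (rw [div_inv_eq_mul]; ring)
    · rw [← one_div, lt_div_iff₀ hm]; linarith
    · rw [← one_div, lt_div_iff₀ hp]; linarith

/-! ### Hypergeometric form of the moments. -/

theorem integral_posPart_sub_gammaMeasure_eq_gaussHypergeometric {n k : ℕ} (hn : 1 ≤ n)
    (hk : 1 ≤ k) {c d : ℝ} (hc : 0 < c) (hd : 0 < d) :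
    ((∫ p : ℝ × ℝ, max (p.1 - p.2) 0 ^ k
        ∂((gammaMeasure (n / 2) c⁻¹).prod (gammaMeasure (n / 2) d⁻¹)) : ℝ) : ℂ) =
      (((n + k - 1)! * k ! / ((c * d) ^ ((n : ℝ) / 2) * Real.Gamma ((n : ℝ) / 2 + k + 1) *
        Real.Gamma ((n : ℝ) / 2)) : ℝ) : ℂ) *
      ((c : ℂ) ^ (n + k) *
        gaussHypergeometric (n + k) (n / 2) (n / 2 + k + 1) (-((c : ℂ) / d))) := by
  have hr : (0 : ℝ) < n / 2 := by positivity
  have hk1 : (0 : ℝ) < k + 1 := by positivity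
  have hF := gaussHypergeometric_neg_ofReal hr hk1 (N := n + k) (by omega)
    (t := c / d) (by positivity)
  have e1 : ((n + k : ℕ) : ℂ) = (n : ℂ) + k := by push_cast; ring
  have e2 : ((n / 2 : ℝ) : ℂ) = (n : ℂ) / 2 := by push_cast; ring
  have e3 : ((n / 2 + (k + 1) : ℝ) : ℂ) = (n : ℂ) / 2 + k + 1 := by push_cast; ring
  have e4 : ((c / d : ℝ) : ℂ) = (c : ℂ) / d := by push_cast; ring
  rw [e1, e2, e3, e4] at hF
  rw [hF, (integral_posPart_sub_gammaMeasure hr (inv_pos.2 hc) (inv_pos.2 hd) hk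
    (N := n + k) (by push_cast; ring)).2]
  -- Factoring out `c⁻¹` brings the integrand to Euler's form with argument `-(c / d)`.
  have hI : ∫ u, ((c⁻¹ + d⁻¹ * u) ^ (n + k))⁻¹ ∂betaMeasure (n / 2) (k + 1) =
      c ^ (n + k) * ∫ u, ((1 + c / d * u) ^ (n + k))⁻¹ ∂betaMeasure (n / 2) (k + 1) := by
    rw [← integral_const_mul]
    congr with u
    have : c⁻¹ + d⁻¹ * u = c⁻¹ * (1 + c / d * u) := by field_simp
    rw [this, mul_pow, mul_inv, inv_pow, inv_inv]
  have hΓ := Real.Gamma_pos_of_pos hr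
  have hΓ' := Real.Gamma_pos_of_pos (by positivity : (0 : ℝ) < n / 2 + k + 1)
  have e5 : (n / 2 + (k + 1) : ℝ) = n / 2 + k + 1 := by ring
  have hcr := Real.rpow_pos_of_pos hc ((n : ℝ) / 2)
  have hdr := Real.rpow_pos_of_pos hd ((n : ℝ) / 2)
  rw [hI, beta, Real.Gamma_nat_eq_factorial, e5, Real.inv_rpow hc.le, Real.inv_rpow hd.le,
    Real.mul_rpow hc.le hd.le, ← Complex.ofReal_pow, ← Complex.ofReal_mul, ← Complex.ofReal_mul]
  congr 1
  field_simp

theorem integral_pow_sub_gammaMeasure {a α β : ℝ} (ha : 0 < a) (hα : 0 < α) (hβ : 0 < β)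
    {k N : ℕ} (hk : 1 ≤ k) (hN : (N : ℝ) = 2 * a + k) :
    Integrable (fun p : ℝ × ℝ => (p.1 - p.2) ^ k) ((gammaMeasure a α).prod (gammaMeasure a β)) ∧
    ∫ p : ℝ × ℝ, (p.1 - p.2) ^ k ∂((gammaMeasure a α).prod (gammaMeasure a β)) =
      (-1) ^ k * ∫ p : ℝ × ℝ, max (p.1 - p.2) 0 ^ k ∂((gammaMeasure a β).prod (gammaMeasure a α)) +
        ∫ p : ℝ × ℝ, max (p.1 - p.2) 0 ^ k ∂((gammaMeasure a α).prod (gammaMeasure a β)) ∧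
    ∫ p : ℝ × ℝ, |(p.1 - p.2) ^ k| ∂((gammaMeasure a α).prod (gammaMeasure a β)) =
      ∫ p : ℝ × ℝ, max (p.1 - p.2) 0 ^ k ∂((gammaMeasure a β).prod (gammaMeasure a α)) +
        ∫ p : ℝ × ℝ, max (p.1 - p.2) 0 ^ k ∂((gammaMeasure a α).prod (gammaMeasure a β)) := by
  have := isProbabilityMeasure_gammaMeasure ha hα
  have := isProbabilityMeasure_gammaMeasure ha hβ
  -- For `k = 0` both parts would contribute `0 ^ 0 = 1`, and the splitting below would fail.
  have hk0 : k ≠ 0 := Nat.one_le_iff_ne_zero.1 hk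
  have h1 := (integral_posPart_sub_gammaMeasure ha hα hβ hk hN).1
  have h2 : Integrable (fun p : ℝ × ℝ => max (p.2 - p.1) 0 ^ k)
      ((gammaMeasure a α).prod (gammaMeasure a β)) :=
    (integral_posPart_sub_gammaMeasure ha hβ hα hk hN).1.swap
  have hswap : ∫ p : ℝ × ℝ, max (p.2 - p.1) 0 ^ k ∂((gammaMeasure a α).prod (gammaMeasure a β)) =
      -- Swapping the factors turns the negative part into a positive part with the rates exchanged,
      -- so one formula serves both.
      ∫ p : ℝ × ℝ, max (p.1 - p.2) 0 ^ k ∂((gammaMeasure a β).prod (gammaMeasure a α)) :=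
    integral_prod_swap (μ := gammaMeasure a β) (ν := gammaMeasure a α)
      (fun p : ℝ × ℝ => max (p.1 - p.2) 0 ^ k)
  have hpow : ∀ p : ℝ × ℝ, (p.1 - p.2) ^ k =
      (-1) ^ k * max (p.2 - p.1) 0 ^ k + max (p.1 - p.2) 0 ^ k := by
    intro p
    rcases le_total p.1 p.2 with h | h
    · rw [max_eq_right (sub_nonpos.2 h), max_eq_left (sub_nonneg.2 h), ← mul_pow, zero_pow hk0]
      ring_nf
    · rw [max_eq_right (sub_nonpos.2 h), max_eq_left (sub_nonneg.2 h), zero_pow hk0]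
      ring
  have habs : ∀ p : ℝ × ℝ, |(p.1 - p.2) ^ k| =
      max (p.2 - p.1) 0 ^ k + max (p.1 - p.2) 0 ^ k := by
    intro p
    rw [abs_pow]
    rcases le_total p.1 p.2 with h | h
    · rw [max_eq_right (sub_nonpos.2 h), max_eq_left (sub_nonneg.2 h), zero_pow hk0,
        abs_of_nonpos (sub_nonpos.2 h)]
      ring_nf
    · rw [max_eq_right (sub_nonpos.2 h), max_eq_left (sub_nonneg.2 h), zero_pow hk0,
        abs_of_nonneg (sub_nonneg.2 h)]
      ring
  simp_rw [habs, hpow, ← hswap]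
  exact ⟨(h2.const_mul _).add h1, by rw [integral_add (h2.const_mul _) h1, integral_const_mul],
    integral_add h2 h1⟩

theorem mainTheorem11
    {Ω' : Type*} [MeasurableSpace Ω'] (P' : Measure Ω') [IsProbabilityMeasure P']
    {Ω : Type*} [MeasurableSpace Ω] (P : Measure Ω) [IsProbabilityMeasure P]
    (X Y : Ω' → ℝ) (σX σY ρ : ℝ) (hσX : 0 < σX) (hσY : 0 < σY) (hρ : -1 < ρ) (hρ' : ρ < 1)
    (hXY : IsCenteredBivariateNormal P' X Y σX σY ρ)
    (n : ℕ) (hn : 1 ≤ n) (Z : Fin n → Ω → ℝ)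
    (hZindep : iIndepFun Z P)
    (hZ : ∀ i, IdentDistrib (Z i) (fun ω => X ω * Y ω) P P')
    (k : ℕ) (hk : 1 ≤ k) :
    Integrable (fun ω => sampleMean Z ω ^ k) P ∧
    ((∫ ω, sampleMean Z ω ^ k ∂P : ℝ) : ℂ) =
      (((σX * σY / n) ^ k * (n + k - 1)! * k ! /
        ((1 - ρ ^ 2) ^ ((n : ℝ) / 2) * Real.Gamma ((n : ℝ) / 2 + k + 1) *
          Real.Gamma ((n : ℝ) / 2)) : ℝ) : ℂ) *
      ((-1) ^ k * (1 - (ρ : ℂ)) ^ (n + k) *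
          gaussHypergeometric (n + k) (n / 2) (n / 2 + k + 1) (-((1 - ρ) / (1 + ρ))) +
        (1 + (ρ : ℂ)) ^ (n + k) *
          gaussHypergeometric (n + k) (n / 2) (n / 2 + k + 1) (-((1 + ρ) / (1 - ρ)))) ∧
    ((∫ ω, |sampleMean Z ω ^ k| ∂P : ℝ) : ℂ) =
      (((σX * σY / n) ^ k * (n + k - 1)! * k ! /
        ((1 - ρ ^ 2) ^ ((n : ℝ) / 2) * Real.Gamma ((n : ℝ) / 2 + k + 1) *
          Real.Gamma ((n : ℝ) / 2)) : ℝ) : ℂ) *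
      ((1 - (ρ : ℂ)) ^ (n + k) *
          gaussHypergeometric (n + k) (n / 2) (n / 2 + k + 1) (-((1 - ρ) / (1 + ρ))) +
        (1 + (ρ : ℂ)) ^ (n + k) *
          gaussHypergeometric (n + k) (n / 2) (n / 2 + k + 1) (-((1 + ρ) / (1 - ρ)))) := by
  have hr : (0 : ℝ) < n / 2 := by positivity
  have hp : 0 < 1 + ρ := by linarith
  have hm : 0 < 1 - ρ := by linarith
  have hs : 0 < σX * σY / n := by positivity
  set s := σX * σY / n with hsdef
  set W : Ω → ℝ := fun ω => (∑ i, Z i ω) / (σX * σY) with hW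
  have hmean : ∀ ω, sampleMean Z ω ^ k = s ^ k * W ω ^ k := by
    intro ω
    rw [← mul_pow, sampleMean, hW, hsdef]
    congr 1
    field_simp
  have hZm : ∀ i, AEMeasurable (Z i) P := fun i => (hZ i).aemeasurable_fst
  have hWm : AEMeasurable W P := by fun_prop
  have hlaw : P.map W = _ := map_sum_eq_map_sub_gammaMeasure hσX hσY hρ hρ' hXY hn hZindep hZ
  have htransfer : ∀ f : ℝ → ℝ, Continuous f → ∫ ω, f (W ω) ∂P =
      ∫ p : ℝ × ℝ, f (p.1 - p.2)
        ∂((gammaMeasure (n / 2) (1 + ρ)⁻¹).prod (gammaMeasure (n / 2) (1 - ρ)⁻¹)) := by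
    intro f hf
    rw [← integral_map hWm hf.aestronglyMeasurable, hlaw,
      integral_map (by fun_prop) hf.aestronglyMeasurable]
  obtain ⟨hint, hpow, habs⟩ := integral_pow_sub_gammaMeasure hr (inv_pos.2 hp) (inv_pos.2 hm) hk
    (N := n + k) (by push_cast; ring)
  have hintW : Integrable (fun ω => W ω ^ k) P := by
    have hc : Continuous fun x : ℝ => x ^ k := by fun_prop
    have h : Integrable (fun x : ℝ => x ^ k) (P.map W) := by
      rw [hlaw, integrable_map_measure hc.aestronglyMeasurable (by fun_prop)]
      exact hint
    exact (integrable_map_measure hc.aestronglyMeasurable hWm).1 h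
  have hplus := integral_posPart_sub_gammaMeasure_eq_gaussHypergeometric hn hk hp hm
  have hminus := integral_posPart_sub_gammaMeasure_eq_gaussHypergeometric hn hk hm hp
  have e1 : (1 + ρ) * (1 - ρ) = 1 - ρ ^ 2 := by ring
  have e2 : (1 - ρ) * (1 + ρ) = 1 - ρ ^ 2 := by ring
  rw [e1] at hplus
  rw [e2] at hminus
  simp only [Complex.ofReal_add, Complex.ofReal_sub, Complex.ofReal_one] at hplus hminus
  simp_rw [hmean, abs_mul, abs_of_pos (pow_pos hs k)]
  refine ⟨hintW.const_mul _, ?_, ?_⟩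
  · rw [integral_const_mul, htransfer (fun x => x ^ k) (by fun_prop), hpow, Complex.ofReal_mul,
      Complex.ofReal_add, Complex.ofReal_mul, hplus, hminus]
    push_cast
    ring
  · rw [integral_const_mul, htransfer (fun x => |x ^ k|) (by fun_prop), habs, Complex.ofReal_mul,
      Complex.ofReal_add, hplus, hminus]
    push_cast
    ring
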